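/- Let $A=\bigoplus_{n\in\mathbb Z,\,l\ge 0}A_{n,l}$, where $A_{n,l}$ is the complex vector space of all (possibly infinite) formal sums of monomials $x_{i_1}^{a_1}\cdots x_{i_m}^{a_m}$ in commuting variables $x_i$, $i\in\mathbb Z$, with $\sum_j a_j i_j=n$ and $\sum_j a_j=l$; this is a commutative $\mathbb C$-algebra graded by bidegree, with $\deg x_i=(i,1)$. The ideal of $A$ generated by a family $(g_j)$ means the set of all formal sums $\sum_j p_jg_j$ lying in $A$, with $p_j\in A$. For $N\in\mathbb Z$ let $C_N$ be the ideal generated by $x_{N+1},x_{N+2},\dots$, and for a quotient $Q$ of $A$ by a homogeneous ideal put $\dim_N Q_{n,l}=\dim_{\mathbb C}(Q/C_N)_{n,l}$. **Theorem 5.1.** For $q\in\mathbb C$ let $I_q$ be the ideal of $A$ generated by the elements $$y_i(q)=\sum_{\alpha\in\mathbb Z}(-1)^\alpha q^{\alpha(3\alpha-1)/2}\,x_{i+3\alpha}\,x_{i+1-3\alpha},\qquad i\in\mathbb Z,$$ and let $B_q=A/I_q$. Then $B_q$, $|q|<1$, is a flat deformation of $A/(x_ix_{i+1},\ i\in\mathbb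 Z)$. That is, each $y_i(q)$ is homogeneous, of a bidegree that does not depend on $q$, one has $y_i(0)=x_ix_{i+1}$, and for every $q\in\mathbb C$ with $|q|<1$ $$\dim_N (B_q)_{n,l}=\dim_N \bigl(A/(x_ix_{i+1},\ i\in\mathbb Z)\bigr)_{n,l}\qquad\text{for all } N,n\in\mathbb Z,\ l\ge 0 .$$ -/

import Mathlib

noncomputable section

namespace FlatDef

/-- The bidegree of a monomial `∏ x_i ^ (s i)` in the variables `x_i`, `i ∈ ℤ`:
`(∑ i, s i * i, ∑ i, s i)`, so that `deg x_i = (i, 1)`. -/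
def bideg (s : ℤ →₀ ℕ) : ℤ × ℕ :=
  (s.sum fun i a => (a : ℤ) * i, s.sum fun _ a => a)

theorem bideg_zero : bideg 0 = 0 := by
  simp [bideg]

theorem bideg_add (s t : ℤ →₀ ℕ) : bideg (s + t) = bideg s + bideg t := by
  unfold bideg
  rw [Finsupp.sum_add_index' (by simp) (by intros; push_cast; ring),
    Finsupp.sum_add_index' (by simp) (by intros; rfl)]
  rfl

theorem bideg_single (i : ℤ) : bideg (Finsupp.single i 1) = (i, 1) := by
  simp [bideg]

/-- The algebra `A = ⨁ A_{n,l}`, where `A_{n,l}` is the space of all (possibly infinite) formal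
sums of monomials of bidegree `(n, l)` in the commuting variables `x_i`, `i ∈ ℤ`:
the formal series whose monomials have only finitely many bidegrees. -/
def algA : Subalgebra ℂ (MvPowerSeries ℤ ℂ) where
  carrier := {f | (bideg '' {s | MvPowerSeries.coeff s f ≠ 0}).Finite}
  mul_mem' := by
    classical
    intro f g hf hg
    refine (hf.add hg).subset ?_
    rintro _ ⟨s, hs, rfl⟩
    rw [Set.mem_ofPred_eq, MvPowerSeries.coeff_mul] at hs
    obtain ⟨⟨u, v⟩, huv, hne⟩ := Finset.exists_ne_zero_of_sum_ne_zero hs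
    rw [Finset.HasAntidiagonal.mem_antidiagonal] at huv
    dsimp only at huv hne
    rw [← huv, bideg_add]
    exact Set.add_mem_add ⟨u, left_ne_zero_of_mul hne, rfl⟩ ⟨v, right_ne_zero_of_mul hne, rfl⟩
  add_mem' := by
    intro f g hf hg
    refine (hf.union hg).subset ?_
    rintro _ ⟨s, hs, rfl⟩
    by_cases h : MvPowerSeries.coeff s f = 0
    · refine Or.inr ⟨s, ?_, rfl⟩
      intro h'
      exact hs (by rw [map_add, h, h', add_zero])
    · exact Or.inl ⟨s, h, rfl⟩
  algebraMap_mem' := by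
    classical
    intro c
    refine (Set.finite_singleton (0 : ℤ × ℕ)).subset ?_
    rintro _ ⟨s, hs, rfl⟩
    rw [Set.mem_ofPred_eq, MvPowerSeries.algebraMap_apply, MvPowerSeries.coeff_C] at hs
    have : s = 0 := by
      by_contra h
      simp [h] at hs
    rw [this, bideg_zero]
    rfl

/-- The coefficient of an element of `A` at a monomial. -/
abbrev coeffA (s : ℤ →₀ ℕ) (f : algA) : ℂ := MvPowerSeries.coeff s (f : MvPowerSeries ℤ ℂ)

/-- The homogeneous component `A_{n,l}`. -/
def component (n : ℤ) (l : ℕ) : Submodule ℂ algA where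
  carrier := {f | ∀ s, coeffA s f ≠ 0 → bideg s = (n, l)}
  add_mem' := by
    intro f g hf hg s hs
    by_cases h : coeffA s f = 0
    · refine hg s fun h' => hs ?_
      have e : coeffA s (f + g) = coeffA s f + coeffA s g := by simp [coeffA]
      rw [e, h, h', add_zero]
    · exact hf s h
  zero_mem' := by
    intro s hs
    exact absurd (by simp [coeffA]) hs
  smul_mem' := by
    intro c f hf s hs
    refine hf s fun h => hs ?_
    have e : coeffA s (c • f) = c * coeffA s f := by simp [coeffA]
    rw [e, h, mul_zero]

/-- The variable `x_i` as an element of `A`. -/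
def x (i : ℤ) : algA :=
  ⟨MvPowerSeries.X i, by
    classical
    refine (Set.finite_singleton ((i, 1) : ℤ × ℕ)).subset ?_
    rintro _ ⟨s, hs, rfl⟩
    rw [Set.mem_ofPred_eq, MvPowerSeries.coeff_X] at hs
    have : s = Finsupp.single i 1 := by
      by_contra h
      simp [h] at hs
    rw [this, bideg_single]
    rfl⟩

/-- `g` is the formal sum of the family `f`: every monomial occurs in only finitely many
members of the family, and its coefficient in `g` is the sum of its coefficients in them. -/
def IsFormalSum {ι : Type} (f : ι → algA) (g : algA) : Prop :=
  ∀ s, {i | coeffA s (f i) ≠ 0}.Finite ∧ coeffA s g = ∑ᶠ i, coeffA s (f i)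

theorem coeffA_add (s : ℤ →₀ ℕ) (f g : algA) : coeffA s (f + g) = coeffA s f + coeffA s g := by
  simp [coeffA]

theorem coeffA_mul (s : ℤ →₀ ℕ) (f g : algA) :
    coeffA s (f * g) = ∑ p ∈ Finset.HasAntidiagonal.antidiagonal s, coeffA p.1 f * coeffA p.2 g := by
  classical
  simp [coeffA, MvPowerSeries.coeff_mul]

/-- The ideal of `A` generated by a family `g`, in the sense of infinite sums: the set of all
formal sums `∑ p_i g_i` that lie in `A`, with `p_i ∈ A`. -/
def formalIdeal {ι : Type} (g : ι → algA) : Ideal algA where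
  carrier := {f | ∃ p : ι → algA, IsFormalSum (fun i => p i * g i) f}
  add_mem' := by
    rintro f f' ⟨p, hp⟩ ⟨p', hp'⟩
    refine ⟨fun i => p i + p' i, fun s => ?_⟩
    have e : ∀ i, coeffA s ((p i + p' i) * g i) = coeffA s (p i * g i) + coeffA s (p' i * g i) :=
      fun i => by rw [add_mul, coeffA_add]
    simp only [e]
    constructor
    · refine ((hp s).1.union (hp' s).1).subset fun i hi => ?_
      by_contra h
      simp only [Set.mem_union, Set.mem_ofPred_eq, not_or, not_not] at h
      exact hi (by rw [h.1, h.2, add_zero])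
    · rw [finsum_add_distrib (hp s).1 (hp' s).1, coeffA_add, (hp s).2, (hp' s).2]
  zero_mem' := ⟨0, fun s => by simp [coeffA]⟩
  smul_mem' := by
    rintro a f ⟨p, hp⟩
    refine ⟨fun i => a * p i, fun s => ?_⟩
    have e : ∀ i, coeffA s (a * p i * g i) =
        ∑ t ∈ Finset.HasAntidiagonal.antidiagonal s, coeffA t.1 a * coeffA t.2 (p i * g i) :=
      fun i => by rw [mul_assoc, coeffA_mul]
    have hfin : ∀ t ∈ Finset.HasAntidiagonal.antidiagonal s,
        (Function.support fun i => coeffA t.1 a * coeffA t.2 (p i * g i)).Finite := fun t _ =>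
      (hp t.2).1.subset fun i hi => right_ne_zero_of_mul hi
    simp only [e]
    constructor
    · refine ((Finset.HasAntidiagonal.antidiagonal s).finite_toSet.biUnion hfin).subset fun i hi => ?_
      obtain ⟨t, ht, hne⟩ := Finset.exists_ne_zero_of_sum_ne_zero hi
      exact Set.mem_biUnion ht hne
    · rw [finsum_sum_comm _ _ hfin, smul_eq_mul, coeffA_mul]
      refine Finset.sum_congr rfl fun t _ => ?_
      rw [(hp t.2).2, mul_finsum]

/-- The cut-off ideal `C_N`, generated by `x_{N+1}, x_{N+2}, …`. -/
def cutoff (N : ℤ) : Ideal algA :=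
  formalIdeal fun i : {i : ℤ // N < i} => x i

/-- `dim_N Q_{n,l} = dim (Q / C_N)_{n,l}` for the quotient `Q = A / I`: the dimension of the image
of `A_{n,l}` in `(A / I) / C_N`. -/
def dimCut (I : Ideal algA) (N n : ℤ) (l : ℕ) : Cardinal :=
  Module.rank ℂ ((component n l).map
    ((Ideal.Quotient.mkₐ ℂ ((cutoff N).map (Ideal.Quotient.mk I))).comp
      (Ideal.Quotient.mkₐ ℂ I)).toLinearMap)

/-- `f` is a monomial in the variables `x_i`. -/
def IsMonomial (f : algA) : Prop :=
  ∃ s : ℤ →₀ ℕ, f = s.prod fun i a => x i ^ a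

/-- The ideals generated by `g q`, `q ∈ ℂ`, are a deformation of the monomial ideal generated by
`m`: the `m i` are monomials, the `g q i` are homogeneous, and `g 0 = m`. -/
structure IsDeformation {ι : Type} (g : ℂ → ι → algA) (m : ι → algA) : Prop where
  monomial : ∀ i, IsMonomial (m i)
  homogeneous : ∀ i, ∃ n l, ∀ q, g q i ∈ component n l
  zero : ∀ i, g 0 i = m i

/-- `A / I` and `A / I₀` have graded components of the same dimension: for every cut-off and every
bidegree, the cut-off dimensions agree. -/
def SameDims (I I₀ : Ideal algA) : Prop :=
  ∀ (N n : ℤ) (l : ℕ), dimCut I N n l = dimCut I₀ N n l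

/-- The term `(-1)^α q^{α(3α-1)/2} x_{i+3α} x_{i+1-3α}`. -/
def relTerm (q : ℂ) (i α : ℤ) : algA :=
  ((-1 : ℂ) ^ α * q ^ (α * (3 * α - 1) / 2)) • (x (i + 3 * α) * x (i + 1 - 3 * α))

theorem coeffA_relTerm (q : ℂ) (i α : ℤ) (s : ℤ →₀ ℕ) (h : coeffA s (relTerm q i α) ≠ 0) :
    s = Finsupp.single (i + 3 * α) 1 + Finsupp.single (i + 1 - 3 * α) 1 := by
  classical
  by_contra hs
  apply h
  have e : coeffA s (relTerm q i α) = ((-1 : ℂ) ^ α * q ^ (α * (3 * α - 1) / 2)) *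
      MvPowerSeries.coeff s
        (MvPowerSeries.X (i + 3 * α) * MvPowerSeries.X (i + 1 - 3 * α) : MvPowerSeries ℤ ℂ) := by
    simp [coeffA, relTerm, x]
  rw [e, MvPowerSeries.X, MvPowerSeries.X, MvPowerSeries.monomial_mul_monomial,
    MvPowerSeries.coeff_monomial, if_neg hs, mul_zero]

theorem relTerm_finite (q : ℂ) (i : ℤ) (s : ℤ →₀ ℕ) :
    {α | coeffA s (relTerm q i α) ≠ 0}.Finite := by
  refine (s.support.finite_toSet.preimage (f := fun α : ℤ => i + 3 * α) ?_).subset fun α hα => ?_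
  · intro a _ b _ hab
    dsimp only at hab
    omega
  · have := coeffA_relTerm q i α s hα
    simp only [Set.mem_preimage, Finset.mem_coe, Finsupp.mem_support_iff]
    rw [this]
    simp

theorem bideg_of_relTerm (q : ℂ) (i : ℤ) (s : ℤ →₀ ℕ)
    (h : ∑ᶠ α, coeffA s (relTerm q i α) ≠ 0) : bideg s = (2 * i + 1, 2) := by
  obtain ⟨α, hα⟩ : ∃ α, coeffA s (relTerm q i α) ≠ 0 := by
    by_contra hc
    push Not at hc
    exact h (by simp [hc])
  rw [coeffA_relTerm q i α s hα, bideg_add, bideg_single, bideg_single]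
  ext
  · simp only [Prod.fst_add]; ring
  · simp

/-- The formal sum `∑_{α ∈ ℤ} (-1)^α q^{α(3α-1)/2} x_{i+3α} x_{i+1-3α}` in `A`. -/
def rel (q : ℂ) (i : ℤ) : algA :=
  ⟨fun s => ∑ᶠ α, coeffA s (relTerm q i α), by
    refine (Set.finite_singleton ((2 * i + 1, 2) : ℤ × ℕ)).subset ?_
    rintro _ ⟨s, hs, rfl⟩
    exact bideg_of_relTerm q i s hs⟩

theorem rel_isFormalSum (q : ℂ) (i : ℤ) : IsFormalSum (relTerm q i) (rel q i) :=
  fun s => ⟨relTerm_finite q i s, rfl⟩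

end FlatDef

end

/-!
The generators `y_i(q)` are a Gröbner basis, with leading monomials `x_i x_{i+1}`, for every `q`.

Order monomials by the additive weight `energy s = ∑ i, s i * i ^ 2`, smaller energy leading. In
`y_i(q)` the monomial `x_{i+3α} x_{i+1-3α}` exceeds `x_i x_{i+1}` in energy by `6α(3α-1)`, so
`x_i x_{i+1}` is the leading monomial, with coefficient `1`. By Buchberger's criterion it remains to
treat the S-pairs. Coprime leading monomials are handled by the Koszul syzygy `koszul_syzygy`. Two
leading monomials that share a variable are those of `y_{i-1}` and `y_i`, and their S-pair is the
leading part of a linear syzygy (`linear_syzygy`)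

  `∑_β (-1)^β q^{β(β+1)/2} x_{i+2β+1} y_{i-β-1}(q) = 0`,

whose other terms have greater energy. Expanded, it is a double sum over `(β, α)` of the monomials
`x_{i+2β+1} x_{i-β-1+3α} x_{i-β-3α}`. Relative to `i` exactly two of the three indices are odd, and
exchanging their roles is a sign-reversing involution (`syzSwap`) that preserves the monomial and
the power of `q`.

Modulo the cut-off `C_N` only the finitely many monomials of `window N n l` matter in bidegree
`(n, l)`: the coefficients there decide membership in `I_q + C_N`
(`mem_cutoff_sup_formalIdeal_iff`), and the formal sums in `I_q` become finite linear combinations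
of the multiples `x^t y_i(q)`. The Gröbner property makes their span have a basis with one element
for each monomial of the window divisible by some `x_i x_{i+1}` (`finrank_relSpace`). Hence the
cut-off dimension is the number of monomials of the window not so divisible, whatever `q` is
(`dimCut_formalIdeal_rel`), and `q = 0` is the monomial ideal (`rel_zero`). The sums being formal,
no convergence in `q` is involved.
-/

noncomputable section

namespace FlatDef

/-! ### Energy of a monomial -/

/-- The energy `∑ i, s i * i ^ 2` of the monomial `∏ x_i ^ (s i)`. Among the quadratic monomials
`x_a x_b` with `a + b` fixed it grows with `|a - b|`. -/
def energy (s : ℤ →₀ ℕ) : ℤ := s.sum fun i a => (a : ℤ) * i ^ 2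

theorem energy_add (s t : ℤ →₀ ℕ) : energy (s + t) = energy s + energy t := by
  unfold energy
  exact Finsupp.sum_add_index' (by simp) (by intros; push_cast; ring)

theorem energy_single (i : ℤ) : energy (Finsupp.single i 1) = i ^ 2 := by
  simp [energy]

/-- The exponent of the monomial `x_{i+3α} x_{i+1-3α}`. -/
def pair (i α : ℤ) : ℤ →₀ ℕ :=
  Finsupp.single (i + 3 * α) 1 + Finsupp.single (i + 1 - 3 * α) 1

theorem pair_apply (i α j : ℤ) :
    pair i α j = (if i + 3 * α = j then 1 else 0) + (if i + 1 - 3 * α = j then 1 else 0) := by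
  simp [pair, Finsupp.single_apply]

theorem bideg_pair (i α : ℤ) : bideg (pair i α) = (2 * i + 1, 2) := by
  rw [pair, bideg_add, bideg_single, bideg_single]
  ext
  · simp only [Prod.fst_add]; ring
  · simp

theorem energy_pair (i α : ℤ) :
    energy (pair i α) = energy (pair i 0) + 6 * (α * (3 * α - 1)) := by
  simp only [pair, energy_add, energy_single]
  ring

theorem mul_three_mul_sub_one_pos {α : ℤ} (h : α ≠ 0) : 0 < α * (3 * α - 1) := by
  rcases lt_or_gt_of_ne h with h | h
  · exact mul_pos_of_neg_of_neg h (by omega)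
  · exact mul_pos h (by omega)

theorem energy_pair_lt {α : ℤ} (i : ℤ) (h : α ≠ 0) : energy (pair i 0) < energy (pair i α) := by
  have := mul_three_mul_sub_one_pos h
  rw [energy_pair i α]
  omega

/-! ### Multiples of the generators by monomials -/

/-- The coefficient `(-1)^α q^{α(3α-1)/2}` of the generator `rel q i`. -/
def relCoeff (q : ℂ) (α : ℤ) : ℂ := (-1 : ℂ) ^ α * q ^ (α * (3 * α - 1) / 2)

theorem relCoeff_zero (q : ℂ) : relCoeff q 0 = 1 := by simp [relCoeff]

/-- The monomial with exponent `t` as an element of `A`. -/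
def mon (t : ℤ →₀ ℕ) : algA :=
  ⟨MvPowerSeries.monomial t 1, by
    classical
    refine (Set.finite_singleton (bideg t)).subset ?_
    rintro _ ⟨s, hs, rfl⟩
    rw [Set.mem_ofPred_eq, MvPowerSeries.coeff_monomial] at hs
    have : s = t := by
      by_contra h
      simp [h] at hs
    rw [this]
    rfl⟩

theorem coeffA_relTerm_eq (q : ℂ) (i α : ℤ) (s : ℤ →₀ ℕ) :
    coeffA s (relTerm q i α) = if s = pair i α then relCoeff q α else 0 := by
  classical
  have e : coeffA s (relTerm q i α) = ((-1 : ℂ) ^ α * q ^ (α * (3 * α - 1) / 2)) *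
      MvPowerSeries.coeff s
        (MvPowerSeries.X (i + 3 * α) * MvPowerSeries.X (i + 1 - 3 * α) : MvPowerSeries ℤ ℂ) := by
    simp [coeffA, relTerm, x]
  rw [e, MvPowerSeries.X, MvPowerSeries.X, MvPowerSeries.monomial_mul_monomial,
    MvPowerSeries.coeff_monomial, ← pair, ← relCoeff]
  simp

theorem coeffA_rel (q : ℂ) (i : ℤ) (s : ℤ →₀ ℕ) :
    coeffA s (rel q i) = ∑ᶠ α, if s = pair i α then relCoeff q α else 0 := by
  rw [(rel_isFormalSum q i s).2]
  exact finsum_congr fun α => coeffA_relTerm_eq q i α s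

theorem coeffA_mon_mul (t s : ℤ →₀ ℕ) (f : algA) [Decidable (t ≤ s)] :
    coeffA s (mon t * f) = if t ≤ s then coeffA (s - t) f else 0 := by
  classical
  have : coeffA s (mon t * f) = MvPowerSeries.coeff s
      (MvPowerSeries.monomial t 1 * (f : MvPowerSeries ℤ ℂ)) := rfl
  rw [this, MvPowerSeries.coeff_monomial_mul]
  simp [coeffA]

theorem coeffA_mon_mul_rel (q : ℂ) (t : ℤ →₀ ℕ) (i : ℤ) (s : ℤ →₀ ℕ) :
    coeffA s (mon t * rel q i) = ∑ᶠ α, if s = t + pair i α then relCoeff q α else 0 := by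
  classical
  rw [coeffA_mon_mul]
  split_ifs with h
  · rw [coeffA_rel]
    refine finsum_congr fun α => if_congr ?_ rfl rfl
    rw [tsub_eq_iff_eq_add_of_le h, add_comm]
  · symm
    refine (finsum_congr fun α => if_neg ?_).trans finsum_zero
    rintro rfl
    exact h le_self_add

theorem exists_of_coeffA_mon_mul_rel {q : ℂ} {t : ℤ →₀ ℕ} {i : ℤ} {s : ℤ →₀ ℕ}
    (h : coeffA s (mon t * rel q i) ≠ 0) : ∃ α, s = t + pair i α := by
  by_contra hc
  push Not at hc
  apply h
  rw [coeffA_mon_mul_rel]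
  exact (finsum_congr fun α => if_neg (hc α)).trans finsum_zero

theorem coeffA_mon_mul_rel_lead (q : ℂ) (t : ℤ →₀ ℕ) (i : ℤ) :
    coeffA (t + pair i 0) (mon t * rel q i) = 1 := by
  rw [coeffA_mon_mul_rel, finsum_eq_single _ 0, if_pos rfl, relCoeff_zero]
  intro α hα
  refine if_neg fun h => ?_
  have := energy_pair_lt i hα
  rw [add_left_cancel h] at this
  exact lt_irrefl _ this

/-! ### The linear syzygy -/

/-- The coefficient `(-1)^β q^{β(β+1)/2}` of the linear syzygy between the generators. -/
def syzCoeff (q : ℂ) (β : ℤ) : ℂ := (-1 : ℂ) ^ β * q ^ (β * (β + 1) / 2)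

/-- The exchange of the two odd indices in a monomial
`x_{2β+1} x_{-β-1+3α} x_{-β-3α}`, in terms of the pair `(β, α)`. -/
def syzSwap (p : ℤ × ℤ) : ℤ × ℤ :=
  if Even (p.1 + p.2) then ((3 * p.2 - p.1 - 2) / 2, -(p.1 + p.2) / 2)
  else (-(p.1 + 3 * p.2 + 1) / 2, (p.1 - p.2 + 1) / 2)

theorem syzSwap_odd (k α : ℤ) : syzSwap (2 * k + 1 - α, α) = (-(k + 1 + α), k + 1 - α) := by
  have h : ¬ Even (2 * k + 1 - α + α) := by
    rw [Int.even_iff]; omega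
  simp only [syzSwap, if_neg h, Prod.mk.injEq]
  omega

theorem syzSwap_even (k α : ℤ) : syzSwap (2 * k - α, α) = (2 * α - k - 1, - k) := by
  have h : Even (2 * k - α + α) := by
    rw [Int.even_iff]; omega
  simp only [syzSwap, if_pos h, Prod.mk.injEq]
  omega

theorem syzSwap_involutive : Function.Involutive syzSwap := by
  rintro ⟨β, α⟩
  obtain ⟨k, hk⟩ := Int.even_or_odd' (β + α)
  rcases hk with hk | hk
  · obtain rfl : β = 2 * k - α := by omega
    rw [syzSwap_even]
    have := syzSwap_odd (α - k - 1) (-k)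
    rw [show 2 * (α - k - 1) + 1 - -k = 2 * α - k - 1 by ring] at this
    rw [this, Prod.mk.injEq]
    omega
  · obtain rfl : β = 2 * k + 1 - α := by omega
    rw [syzSwap_odd]
    have := syzSwap_even (-α) (k + 1 - α)
    rw [show 2 * (-α) - (k + 1 - α) = -(k + 1 + α) by ring] at this
    rw [this, Prod.mk.injEq]
    omega

/-- The exponent of the monomial `x_{i+2β+1} x_{i-β-1+3α} x_{i-β-3α}`. -/
def triple (i : ℤ) (p : ℤ × ℤ) : ℤ →₀ ℕ :=
  Finsupp.single (i + 2 * p.1 + 1) 1 + pair (i - p.1 - 1) p.2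

theorem triple_odd (i k α : ℤ) :
    triple i (-(k + 1 + α), k + 1 - α) = triple i (2 * k + 1 - α, α) := by
  simp only [triple, pair]
  rw [show i + 2 * -(k + 1 + α) + 1 = i - (2 * k + 1 - α) - 1 + 1 - 3 * α by ring,
    show i - -(k + 1 + α) - 1 + 3 * (k + 1 - α) = i + 2 * (2 * k + 1 - α) + 1 by ring,
    show i - -(k + 1 + α) - 1 + 1 - 3 * (k + 1 - α) = i - (2 * k + 1 - α) - 1 + 3 * α by ring]
  abel

theorem zpow_mul_zpow_of_nonneg (q : ℂ) {a b : ℤ} (ha : 0 ≤ a) (hb : 0 ≤ b) :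
    q ^ a * q ^ b = q ^ (a + b) := by
  refine (zpow_add' ?_).symm
  omega

theorem syzCoeff_mul_relCoeff (q : ℂ) (β α : ℤ) :
    syzCoeff q β * relCoeff q α =
      (-1) ^ (β + α) * q ^ ((β * (β + 1) + α * (3 * α - 1)) / 2) := by
  have hβ : 0 ≤ β * (β + 1) := by
    rcases le_or_gt 0 β with h | h
    · exact mul_nonneg h (by omega)
    · exact mul_nonneg_of_nonpos_of_nonpos (by omega) (by omega)
  have hα : 0 ≤ α * (3 * α - 1) := by
    rcases eq_or_ne α 0 with rfl | h
    · simp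
    · exact (mul_three_mul_sub_one_pos h).le
  have h2 : 2 ∣ β * (β + 1) := (Int.even_mul_succ_self β).two_dvd
  rw [Int.add_ediv_of_dvd_left h2, ← zpow_mul_zpow_of_nonneg q (by omega) (by omega),
    zpow_add₀ (by norm_num), syzCoeff, relCoeff]
  ring

theorem syzCoeff_mul_relCoeff_odd (q : ℂ) (k α : ℤ) :
    syzCoeff q (-(k + 1 + α)) * relCoeff q (k + 1 - α) =
      -(syzCoeff q (2 * k + 1 - α) * relCoeff q α) := by
  rw [syzCoeff_mul_relCoeff, syzCoeff_mul_relCoeff,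
    show -(k + 1 + α) * (-(k + 1 + α) + 1) + (k + 1 - α) * (3 * (k + 1 - α) - 1) =
      (2 * k + 1 - α) * (2 * k + 1 - α + 1) + α * (3 * α - 1) by ring,
    show -(k + 1 + α) + (k + 1 - α) = -α + -α by ring,
    show 2 * k + 1 - α + α = k + k + 1 by ring,
    Even.neg_one_zpow ⟨-α, rfl⟩, Odd.neg_one_zpow ⟨k, by ring⟩]
  ring

theorem triple_syzSwap (i : ℤ) (p : ℤ × ℤ) : triple i (syzSwap p) = triple i p := by
  have key : ∀ p : ℤ × ℤ, Odd (p.1 + p.2) → triple i (syzSwap p) = triple i p := by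
    rintro ⟨β, α⟩ ⟨k, hk⟩
    obtain rfl : β = 2 * k + 1 - α := by dsimp only at hk; omega
    rw [syzSwap_odd, triple_odd]
  rcases Int.even_or_odd' (p.1 + p.2) with ⟨k, hk | hk⟩
  · rw [← key (syzSwap p), syzSwap_involutive]
    obtain ⟨β, α⟩ := p
    obtain rfl : β = 2 * k - α := by dsimp only at hk; omega
    rw [syzSwap_even]
    exact ⟨α - k - 1, by ring⟩
  · exact key p ⟨k, hk⟩

theorem syzCoeff_mul_relCoeff_syzSwap (q : ℂ) (p : ℤ × ℤ) :
    syzCoeff q (syzSwap p).1 * relCoeff q (syzSwap p).2 =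
      -(syzCoeff q p.1 * relCoeff q p.2) := by
  have key : ∀ p : ℤ × ℤ, Odd (p.1 + p.2) → syzCoeff q (syzSwap p).1 * relCoeff q (syzSwap p).2 =
      -(syzCoeff q p.1 * relCoeff q p.2) := by
    rintro ⟨β, α⟩ ⟨k, hk⟩
    obtain rfl : β = 2 * k + 1 - α := by dsimp only at hk; omega
    rw [syzSwap_odd]
    exact syzCoeff_mul_relCoeff_odd q k α
  rcases Int.even_or_odd' (p.1 + p.2) with ⟨k, hk | hk⟩
  · have h := key (syzSwap p) ?_
    · rw [syzSwap_involutive] at h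
      rw [h, neg_neg]
    obtain ⟨β, α⟩ := p
    obtain rfl : β = 2 * k - α := by dsimp only at hk; omega
    rw [syzSwap_even]
    exact ⟨α - k - 1, by ring⟩
  · exact key p ⟨k, hk⟩

theorem triple_finite (t : ℤ →₀ ℕ) (i : ℤ) (s : ℤ →₀ ℕ) :
    {p : ℤ × ℤ | s = t + triple i p}.Finite := by
  have hinj : Function.Injective fun p : ℤ × ℤ => (i + 2 * p.1 + 1, i - p.1 - 1 + 3 * p.2) := by
    rintro ⟨a, b⟩ ⟨a', b'⟩ h
    simp only [Prod.mk.injEq] at h ⊢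
    omega
  refine ((s.support ×ˢ s.support).finite_toSet.preimage hinj.injOn).subset ?_
  rintro p rfl
  simp [triple, pair]

/-- The linear syzygy `∑_β (-1)^β q^{β(β+1)/2} x_{i+2β+1} y_{i-β-1}(q) = 0`, multiplied by a
monomial. The terms of the double sum cancel in pairs under `syzSwap`. -/
theorem linear_syzygy (q : ℂ) (t : ℤ →₀ ℕ) (i : ℤ) (s : ℤ →₀ ℕ) :
    ∑ᶠ β, syzCoeff q β *
      coeffA s (mon (t + Finsupp.single (i + 2 * β + 1) 1) * rel q (i - β - 1)) = 0 := by
  let F : ℤ × ℤ → ℂ := fun p =>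
    if s = t + triple i p then syzCoeff q p.1 * relCoeff q p.2 else 0
  have hF : F.HasFiniteSupport := by
    refine (triple_finite t i s).subset fun p hp => ?_
    by_contra h
    exact hp (if_neg h)
  have h1 : ∑ᶠ p, F p = - ∑ᶠ p, F p := by
    rw [← finsum_neg_distrib, ← finsum_comp_equiv syzSwap_involutive.toPerm]
    refine finsum_congr fun p => ?_
    simp only [F, Function.Involutive.coe_toPerm, triple_syzSwap, syzCoeff_mul_relCoeff_syzSwap]
    split_ifs <;> simp
  have h2 : ∑ᶠ p, F p = 0 := self_eq_neg.mp h1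
  rw [finsum_curry F hF] at h2
  rw [← h2]
  refine finsum_congr fun β => ?_
  rw [coeffA_mon_mul_rel, mul_finsum]
  refine finsum_congr fun α => ?_
  simp only [F, triple, add_assoc, mul_ite, mul_zero]

/-- The Koszul syzygy: multiplying the monomials of one generator into another generator is
symmetric in the two generators. -/
theorem koszul_syzygy (q : ℂ) (t : ℤ →₀ ℕ) (i j : ℤ) (s : ℤ →₀ ℕ) :
    ∑ᶠ α, relCoeff q α * coeffA s (mon (t + pair j α) * rel q i) =
      ∑ᶠ α, relCoeff q α * coeffA s (mon (t + pair i α) * rel q j) := by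
  let F : ℤ × ℤ → ℂ := fun p =>
    if s = t + pair j p.1 + pair i p.2 then relCoeff q p.1 * relCoeff q p.2 else 0
  have hF : F.HasFiniteSupport := by
    have hinj : Function.Injective fun p : ℤ × ℤ => (j + 3 * p.1, i + 3 * p.2) := by
      rintro ⟨a, b⟩ ⟨a', b'⟩ h
      simp only [Prod.mk.injEq] at h ⊢
      omega
    refine ((s.support ×ˢ s.support).finite_toSet.preimage hinj.injOn).subset fun p hp => ?_
    obtain rfl : s = t + pair j p.1 + pair i p.2 := by
      by_contra h
      exact hp (if_neg h)
    simp [pair]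
  have hF' : (fun p : ℤ × ℤ => F p.swap).HasFiniteSupport :=
    (hF.preimage (Prod.swap_injective.injOn)).subset fun p hp => hp
  have h := finsum_comp_equiv (Equiv.prodComm ℤ ℤ) (f := F)
  simp only [Equiv.prodComm_apply] at h
  rw [finsum_curry F hF, finsum_curry _ hF'] at h
  calc _ = ∑ᶠ (a) (b), F (a, b) := by
        refine finsum_congr fun a => ?_
        rw [coeffA_mon_mul_rel, mul_finsum]
        refine finsum_congr fun b => ?_
        simp only [F, mul_ite, mul_zero]
    _ = _ := by
        rw [← h]
        refine finsum_congr fun a => ?_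
        rw [coeffA_mon_mul_rel, mul_finsum]
        refine finsum_congr fun b => ?_
        simp only [F, mul_ite, mul_zero, Prod.swap_prod_mk]
        rw [mul_comm, add_right_comm]

/-! ### The finite set of monomials of a cut-off component -/

/-- The monomials of bidegree `(n, l)` in the variables `x_j`, `j ≤ N`. -/
def window (N n : ℤ) (l : ℕ) : Set (ℤ →₀ ℕ) :=
  {s | bideg s = (n, l) ∧ ∀ j, N < j → s j = 0}

theorem window_finite (N n : ℤ) (l : ℕ) : (window N n l).Finite := by
  classical
  refine (Set.finite_Iic (∑ j ∈ Finset.Icc (n - (l - 1) * N) N, Finsupp.single j l)).subset ?_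
  rintro s ⟨hb, hN⟩
  simp only [bideg, Prod.mk.injEq, Finsupp.sum] at hb
  obtain ⟨hn, hl⟩ := hb
  have hle : ∀ j, s j ≤ l := fun j => by
    by_cases hj : j ∈ s.support
    · rw [← hl]
      exact Finset.single_le_sum (f := s) (fun _ _ => Nat.zero_le _) hj
    · simp [Finsupp.notMem_support_iff.mp hj]
  rw [Set.mem_Iic]
  intro j
  rw [Finsupp.finsetSum_apply]
  by_cases hj : s j = 0
  · simp [hj]
  have hjN : j ≤ N := by
    by_contra h
    exact hj (hN j (by omega))
  -- `N * l - n` is a sum of nonnegative terms `s i * (N - i)`, one of which is at least `N - j`.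
  have hsum : ∑ i ∈ s.support, (s i : ℤ) * (N - i) = l * N - n := by
    rw [← hl, ← hn, Nat.cast_sum, Finset.sum_mul, ← Finset.sum_sub_distrib]
    exact Finset.sum_congr rfl fun i _ => by ring
  have hterm : (s j : ℤ) * (N - j) ≤ ∑ i ∈ s.support, (s i : ℤ) * (N - i) := by
    refine Finset.single_le_sum (f := fun i => (s i : ℤ) * (N - i)) (fun i hi => ?_)
      (Finsupp.mem_support_iff.mpr hj)
    have : i ≤ N := by
      by_contra h
      exact Finsupp.mem_support_iff.mp hi (hN i (by omega))
    exact mul_nonneg (by positivity) (by omega)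
  have hsj : (1 : ℤ) ≤ s j := by exact_mod_cast Nat.one_le_iff_ne_zero.mpr hj
  have hj' : n - (l - 1) * N ≤ j := by
    nlinarith [mul_le_mul_of_nonneg_right hsj (sub_nonneg.mpr hjN)]
  simp only [Finsupp.single_apply]
  rw [Finset.sum_ite_eq', if_pos (Finset.mem_Icc.mpr ⟨hj', hjN⟩)]
  exact hle j

instance (N n : ℤ) (l : ℕ) : Finite (window N n l) := window_finite N n l

theorem finite_of_mem_support {K : Type*} {N n : ℤ} {l : ℕ} (v : K → (ℤ →₀ ℕ)) (φ : K → ℤ)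
    (hφ : Function.Injective φ) (h : ∀ k, v k (φ k) ≠ 0) : {k | v k ∈ window N n l}.Finite := by
  have hfin : (⋃ s ∈ window N n l, (s.support : Set ℤ)).Finite :=
    (window_finite N n l).biUnion fun s _ => s.support.finite_toSet
  refine (hfin.preimage hφ.injOn).subset fun k hk => ?_
  exact Set.mem_biUnion hk (by simpa using h k)

/-! ### The relations of a cut-off component -/

/-- The smallest-energy monomial `x^t x_i x_{i+1}` of the multiple `x^t y_i` of a generator,
where `p = (t, i)`. -/
def lead (p : (ℤ →₀ ℕ) × ℤ) : ℤ →₀ ℕ := p.1 + pair p.2 0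

/-- The multiple `x^t y_i(q)` of a generator, restricted to the monomials of `window N n l`,
where `p = (t, i)`. -/
def row (N n : ℤ) (l : ℕ) (q : ℂ) (p : (ℤ →₀ ℕ) × ℤ) : window N n l → ℂ :=
  fun s => coeffA s (mon p.1 * rel q p.2)

variable {N n : ℤ} {l : ℕ} {q : ℂ}

/-- If the leading monomial of `x^t y_i` lies outside the window, so do all its monomials: the
larger index of `x_{i+3α} x_{i+1-3α}` is at least `i + 1`. -/
theorem row_eq_zero {p : (ℤ →₀ ℕ) × ℤ} (h : lead p ∉ window N n l) : row N n l q p = 0 := by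
  ext ⟨s, hs⟩
  by_contra hne
  obtain ⟨α, rfl⟩ := exists_of_coeffA_mon_mul_rel hne
  refine h ⟨?_, fun j hj => ?_⟩
  · rw [← hs.1, lead, bideg_add, bideg_add, bideg_pair, bideg_pair]
  · have h1 := hs.2 j hj
    rw [lead]
    rw [Finsupp.add_apply] at h1 ⊢
    have h2 : ¬ N < p.2 + 3 * α := fun h => by
      have := hs.2 _ h
      rw [Finsupp.add_apply, pair_apply, if_pos rfl] at this
      omega
    have h3 : ¬ N < p.2 + 1 - 3 * α := fun h => by
      have := hs.2 _ h
      rw [Finsupp.add_apply, pair_apply, if_pos rfl] at this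
      omega
    rw [pair_apply, if_neg (by omega), if_neg (by omega)]
    omega

theorem row_lead {p : (ℤ →₀ ℕ) × ℤ} (h : lead p ∈ window N n l) :
    row N n l q p ⟨lead p, h⟩ = 1 :=
  coeffA_mon_mul_rel_lead q p.1 p.2

theorem eq_or_energy_lt_of_row_ne_zero {p : (ℤ →₀ ℕ) × ℤ} {s : window N n l}
    (h : row N n l q p s ≠ 0) : (s : ℤ →₀ ℕ) = lead p ∨ energy (lead p) < energy s := by
  obtain ⟨α, hα⟩ := exists_of_coeffA_mon_mul_rel h
  rcases eq_or_ne α 0 with rfl | h0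
  · exact Or.inl hα
  · right
    rw [hα, lead, energy_add, energy_add]
    have := energy_pair_lt p.2 h0
    omega

/-- The span of the relations whose leading monomial has energy greater than `e`. -/
def rowsAbove (N n : ℤ) (l : ℕ) (q : ℂ) (e : ℤ) : Submodule ℂ (window N n l → ℂ) :=
  Submodule.span ℂ (row N n l q '' {p | e < energy (lead p)})

/-- In a formal sum of relations, the terms of energy greater than `e` may be dropped modulo
`rowsAbove`; only finitely many of them meet the window. -/
theorem finsum_sub_sum_mem_rowsAbove {K : Type*} (c : K → ℂ) (p : K → (ℤ →₀ ℕ) × ℤ)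
    (hfin : {k | lead (p k) ∈ window N n l}.Finite) (X : Finset K) {e : ℤ}
    (hX : ∀ k ∉ X, e < energy (lead (p k))) :
    (fun s : window N n l => ∑ᶠ k, c k * coeffA s (mon (p k).1 * rel q (p k).2)) -
      ∑ k ∈ X, c k • row N n l q (p k) ∈ rowsAbove N n l q e := by
  classical
  have h : (fun s : window N n l => ∑ᶠ k, c k * coeffA s (mon (p k).1 * rel q (p k).2)) =
      ∑ k ∈ hfin.toFinset ∪ X, c k • row N n l q (p k) := by
    ext s
    rw [Finset.sum_apply]
    refine finsum_eq_sum_of_support_subset _ fun k hk => ?_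
    rw [Finset.coe_union, Set.Finite.coe_toFinset]
    left
    by_contra hn
    have := congrFun (row_eq_zero (q := q) hn) s
    exact right_ne_zero_of_mul hk this
  rw [h, ← Finset.sum_sdiff (Finset.subset_union_right (s₁ := hfin.toFinset) (s₂ := X)),
    add_sub_cancel_right]
  refine Submodule.sum_mem _ fun k hk => Submodule.smul_mem _ _ (Submodule.subset_span ?_)
  exact ⟨p k, hX k (Finset.mem_sdiff.mp hk).2, rfl⟩

/-- The S-pair of the generators `y_{i-1}` and `y_i`, whose leading monomials share `x_i`. -/
theorem adjacent_mem_rowsAbove (t : ℤ →₀ ℕ) (i : ℤ) :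
    row N n l q (t + Finsupp.single (i + 1) 1, i - 1) -
      row N n l q (t + Finsupp.single (i - 1) 1, i) ∈
      rowsAbove N n l q (energy (lead (t + Finsupp.single (i - 1) 1, i))) := by
  have h := finsum_sub_sum_mem_rowsAbove (N := N) (n := n) (l := l) (q := q) (syzCoeff q)
    (fun β => (t + Finsupp.single (i + 2 * β + 1) 1, i - β - 1)) ?_ {0, -1}
    (e := energy (lead (t + Finsupp.single (i - 1) 1, i))) ?_
  · simp only [linear_syzygy] at h
    rw [Finset.sum_pair (by norm_num)] at h
    have h0 : syzCoeff q 0 = 1 := by simp [syzCoeff]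
    have h1 : syzCoeff q (-1) = -1 := by simp [syzCoeff]
    rw [h0, h1, show i + 2 * 0 + 1 = i + 1 by ring, show i - 0 - 1 = i - 1 by ring,
      show i + 2 * -1 + 1 = i - 1 by ring, show i - -1 - 1 = i by ring, one_smul,
      neg_smul, one_smul, ← sub_eq_add_neg] at h
    rw [← neg_mem_iff]
    convert h using 1
    ext s
    simp
  · refine finite_of_mem_support _ (fun β => i + 2 * β + 1) (fun a b h => by
      dsimp only at h; omega) fun β => ?_
    simp [lead]
  · intro β hβ
    simp only [Finset.mem_insert, Finset.mem_singleton, not_or] at hβ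
    have : 0 < β * (β + 1) := by
      rcases lt_or_gt_of_ne hβ.1 with h | h
      · exact mul_pos_of_neg_of_neg h (by omega)
      · exact mul_pos h (by omega)
    simp only [lead, pair, energy_add, energy_single]
    nlinarith

/-- The S-pair of two generators whose leading monomials are coprime. -/
theorem koszul_mem_rowsAbove (t : ℤ →₀ ℕ) (i j : ℤ) :
    row N n l q (t + pair j 0, i) - row N n l q (t + pair i 0, j) ∈
      rowsAbove N n l q (energy (lead (t + pair j 0, i))) := by
  have key : ∀ i j : ℤ,
      (fun s : window N n l => ∑ᶠ α, relCoeff q α * coeffA s (mon (t + pair j α) * rel q i)) -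
        row N n l q (t + pair j 0, i) ∈
        rowsAbove N n l q (energy (lead (t + pair j 0, i))) := by
    intro i j
    have h := finsum_sub_sum_mem_rowsAbove (N := N) (n := n) (l := l) (q := q) (relCoeff q)
      (fun α => (t + pair j α, i)) ?_ {0} (e := energy (lead (t + pair j 0, i))) ?_
    · simpa [relCoeff_zero] using h
    · refine finite_of_mem_support _ (fun α => j + 3 * α) (fun a b h => by
        dsimp only at h; omega) fun α => ?_
      simp [lead, pair]
    · intro α hα
      have := energy_pair_lt j (by simpa using hα)
      simp only [lead, energy_add] at this ⊢
      omega
  have h1 := key i j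
  have h2 := key j i
  rw [show lead (t + pair i 0, j) = lead (t + pair j 0, i) from add_right_comm _ _ _] at h2
  simp only [koszul_syzygy q t j i] at h2
  have := Submodule.sub_mem _ h2 h1
  rwa [sub_sub_sub_cancel_left] at this

/-- Buchberger's criterion for the generators: two relations with the same leading monomial differ
by relations of greater energy. -/
theorem row_sub_row_mem_rowsAbove {p p' : (ℤ →₀ ℕ) × ℤ} (h : lead p = lead p') :
    row N n l q p - row N n l q p' ∈ rowsAbove N n l q (energy (lead p)) := by
  wlog hle : p.2 ≤ p'.2 generalizing p p'
  · rw [← neg_mem_iff, neg_sub, h]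
    exact this h.symm (by omega)
  obtain ⟨t, i⟩ := p
  obtain ⟨t', i'⟩ := p'
  dsimp only at hle
  have hk : ∀ k, t k + pair i 0 k = t' k + pair i' 0 k := fun k => DFunLike.congr_fun h k
  rcases hle.eq_or_lt with rfl | hlt
  · obtain rfl : t = t' := add_right_cancel (h : t + pair i 0 = t' + pair i 0)
    rw [sub_self]
    exact zero_mem _
  rcases eq_or_ne i' (i + 1) with rfl | hne
  · obtain ⟨r, rfl⟩ : ∃ r, t = r + Finsupp.single (i + 1 + 1) 1 := by
      refine ⟨t - Finsupp.single (i + 1 + 1) 1, (tsub_add_cancel_of_le ?_).symm⟩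
      rw [Finsupp.single_le_iff]
      have := hk (i + 1 + 1)
      rw [pair_apply, pair_apply] at this
      split_ifs at this <;> omega
    obtain rfl : t' = r + Finsupp.single i 1 := by
      ext k
      have := hk k
      rw [pair_apply, pair_apply, Finsupp.add_apply, Finsupp.single_apply] at this
      rw [Finsupp.add_apply, Finsupp.single_apply]
      split_ifs at this ⊢ <;> omega
    rw [h]
    have := adjacent_mem_rowsAbove (N := N) (n := n) (l := l) (q := q) r (i + 1)
    rwa [add_sub_cancel_right] at this
  · obtain ⟨r, rfl⟩ : ∃ r, t = r + pair i' 0 := by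
      refine ⟨t - pair i' 0, (tsub_add_cancel_of_le fun k => ?_).symm⟩
      have := hk k
      rw [pair_apply, pair_apply] at this
      rw [pair_apply]
      split_ifs at this ⊢ <;> omega
    obtain rfl : t' = r + pair i 0 := by
      refine add_right_cancel (b := pair i' 0) ?_
      rw [add_right_comm]
      exact h.symm
    exact koszul_mem_rowsAbove r i i'

/-! ### The dimension of the relations -/

/-- The relations of the cut-off component: the span of the multiples `x^t y_i(q)` restricted to
`window N n l`. -/
def relSpace (N n : ℤ) (l : ℕ) (q : ℂ) : Submodule ℂ (window N n l → ℂ) :=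
  Submodule.span ℂ (Set.range (row N n l q))

/-- The monomials of the window divisible by some `x_i x_{i+1}`. -/
def nonstandard (N n : ℤ) (l : ℕ) : Set (window N n l) :=
  {s | ∃ p, lead p = s}

/-- One relation for each nonstandard monomial, with that monomial as its leading one. -/
def basisRow (N n : ℤ) (l : ℕ) (q : ℂ) (s : nonstandard N n l) : window N n l → ℂ :=
  row N n l q s.2.choose

theorem lead_choose (s : nonstandard N n l) : lead s.2.choose = (s : window N n l) :=
  s.2.choose_spec

theorem linearIndependent_basisRow : LinearIndependent ℂ (basisRow N n l q) := by
  classical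
  have := Fintype.ofFinite (nonstandard N n l)
  rw [Fintype.linearIndependent_iff]
  intro a ha
  by_contra! hne
  -- Among the monomials with nonzero coefficient, take one of least energy: it occurs in no
  -- other relation.
  obtain ⟨s, hs, hmin⟩ := Set.exists_min_image {s | a s ≠ 0}
    (fun s => energy ((s : window N n l) : ℤ →₀ ℕ)) (Set.toFinite _) hne
  have h := congrFun ha s
  rw [Finset.sum_apply, Finset.sum_eq_single s] at h
  · have h1 : basisRow N n l q s s = 1 := by
      have hl := lead_choose s
      have hm : lead s.2.choose ∈ window N n l := by
        rw [hl]
        exact s.1.2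
      have := row_lead (q := q) hm
      have e : (⟨lead s.2.choose, hm⟩ : window N n l) = s := Subtype.ext hl
      rwa [e] at this
    rw [Pi.smul_apply, h1, smul_eq_mul, mul_one] at h
    exact hs h
  · intro s' _ hs'
    by_contra hc
    rw [Pi.smul_apply, smul_eq_mul] at hc
    have h1 := hmin s' (left_ne_zero_of_mul hc)
    rcases eq_or_energy_lt_of_row_ne_zero (right_ne_zero_of_mul hc) with h2 | h2
    · rw [lead_choose] at h2
      exact hs' (Subtype.ext (Subtype.ext h2)).symm
    · rw [lead_choose] at h2
      omega
  · simp

theorem row_mem_span_basisRow (p : (ℤ →₀ ℕ) × ℤ) :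
    row N n l q p ∈ Submodule.span ℂ (Set.range (basisRow N n l q)) := by
  obtain ⟨B, hB⟩ := ((window_finite N n l).image energy).bddAbove
  induction hm : (B - energy (lead p)).toNat using Nat.strong_induction_on generalizing p with
  | _ m ih =>
  by_cases hp : lead p ∈ window N n l
  · have hpB : energy (lead p) ≤ B := hB ⟨_, hp, rfl⟩
    let s : nonstandard N n l := ⟨⟨lead p, hp⟩, p, rfl⟩
    have h1 : row N n l q p - basisRow N n l q s ∈ rowsAbove N n l q (energy (lead p)) :=
      row_sub_row_mem_rowsAbove (lead_choose s).symm
    have h2 : rowsAbove N n l q (energy (lead p)) ≤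
        Submodule.span ℂ (Set.range (basisRow N n l q)) := by
      refine Submodule.span_le.mpr ?_
      rintro _ ⟨p', hp', rfl⟩
      have hp' : energy (lead p) < energy (lead p') := hp'
      by_cases hw : lead p' ∈ window N n l
      · have : energy (lead p') ≤ B := hB ⟨_, hw, rfl⟩
        exact ih _ (by omega) p' rfl
      · rw [row_eq_zero hw]
        exact zero_mem _
    have h3 := Submodule.add_mem _ (h2 h1) (Submodule.subset_span (Set.mem_range_self s))
    rwa [sub_add_cancel] at h3
  · rw [row_eq_zero hp]
    exact zero_mem _

/-- The relations have as many dimensions as there are nonstandard monomials, whatever `q` is. -/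
theorem finrank_relSpace (N n : ℤ) (l : ℕ) (q : ℂ) :
    Module.finrank ℂ (relSpace N n l q) = Nat.card (nonstandard N n l) := by
  have := Fintype.ofFinite (nonstandard N n l)
  have h : relSpace N n l q = Submodule.span ℂ (Set.range (basisRow N n l q)) := by
    refine le_antisymm (Submodule.span_le.mpr ?_) (Submodule.span_le.mpr ?_)
    · rintro _ ⟨p, rfl⟩
      exact row_mem_span_basisRow p
    · rintro _ ⟨s, rfl⟩
      exact Submodule.subset_span (Set.mem_range_self _)
  rw [h, finrank_span_eq_card linearIndependent_basisRow, Nat.card_eq_fintype_card]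

/-! ### The formal ideals in terms of coefficients -/

theorem coeffA_smul (s : ℤ →₀ ℕ) (c : ℂ) (f : algA) : coeffA s (c • f) = c * coeffA s f := by
  simp [coeffA]

theorem coeffA_sub (s : ℤ →₀ ℕ) (f g : algA) : coeffA s (f - g) = coeffA s f - coeffA s g := by
  simp [coeffA]

theorem coeffA_zero (s : ℤ →₀ ℕ) : coeffA s 0 = 0 := by
  simp [coeffA]

theorem x_eq_mon (i : ℤ) : x i = mon (Finsupp.single i 1) := by
  ext1
  simp [x, mon, MvPowerSeries.X]

theorem coeffA_mul_x (s : ℤ →₀ ℕ) (i : ℤ) (f : algA) :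
    coeffA s (f * x i) = if s i = 0 then 0 else coeffA (s - Finsupp.single i 1) f := by
  classical
  rw [mul_comm, x_eq_mon, coeffA_mon_mul]
  by_cases h : s i = 0
  · rw [if_pos h, if_neg]
    rw [Finsupp.single_le_iff]
    omega
  · rw [if_neg h, if_pos]
    rw [Finsupp.single_le_iff]
    omega

theorem coeffA_eq_zero_of_mem_cutoff {N : ℤ} {f : algA} (hf : f ∈ cutoff N) {s : ℤ →₀ ℕ}
    (hs : ∀ j, N < j → s j = 0) : coeffA s f = 0 := by
  obtain ⟨p, hp⟩ := hf
  rw [(hp s).2]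
  refine (finsum_congr fun i => ?_).trans finsum_zero
  rw [coeffA_mul_x, if_pos (hs i i.2)]

/-- The variable `x_i` may be factored out of each monomial of a homogeneous series with one index
above `N`; the choice `κ` says which one is factored out. -/
theorem mem_cutoff_of_coeffA_eq_zero {N n : ℤ} {l : ℕ} {f : algA} (hf : f ∈ component n l)
    (h : ∀ s, (∀ j, N < j → s j = 0) → coeffA s f = 0) : f ∈ cutoff N := by
  classical
  have hex : ∀ s : ℤ →₀ ℕ, ∃ i : {i : ℤ // N < i}, (∃ j, N < j ∧ s j ≠ 0) → s i ≠ 0 := by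
    intro s
    by_cases hs : ∃ j, N < j ∧ s j ≠ 0
    · obtain ⟨j, hj, hj'⟩ := hs
      exact ⟨⟨j, hj⟩, fun _ => hj'⟩
    · exact ⟨⟨N + 1, by omega⟩, fun h => absurd h hs⟩
  choose κ hκ using hex
  let c : {i : ℤ // N < i} → MvPowerSeries ℤ ℂ := fun i t =>
    if κ (t + Finsupp.single (i : ℤ) 1) = i then coeffA (t + Finsupp.single (i : ℤ) 1) f else 0
  have hc : ∀ i, c i ∈ algA := by
    intro i
    refine (Set.finite_singleton ((n, l) - ((i : ℤ), 1) : ℤ × ℕ)).subset ?_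
    rintro _ ⟨t, ht, rfl⟩
    have ht : c i t ≠ 0 := ht
    have h1 : coeffA (t + Finsupp.single (i : ℤ) 1) f ≠ 0 := fun h0 => ht (by simp [c, h0])
    have h2 := hf _ h1
    rw [bideg_add, bideg_single] at h2
    rw [Set.mem_singleton_iff, ← h2]
    ext <;> simp
  refine ⟨fun i => ⟨c i, hc i⟩, fun s => ?_⟩
  have e : ∀ i : {i : ℤ // N < i}, coeffA s ((⟨c i, hc i⟩ : algA) * x i) =
      if κ s = i then coeffA s f else 0 := by
    intro i
    rw [coeffA_mul_x]
    by_cases hi : s i = 0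
    · rw [if_pos hi]
      split_ifs with hκi
      · refine (h s fun j hj => ?_).symm
        by_contra hj'
        exact hκ s ⟨j, hj, hj'⟩ (hκi ▸ hi)
      · rfl
    · rw [if_neg hi]
      have hle : Finsupp.single (i : ℤ) 1 ≤ s := by
        rw [Finsupp.single_le_iff]
        omega
      change c i (s - Finsupp.single (i : ℤ) 1) = _
      simp only [c]
      rw [tsub_add_cancel_of_le hle]
  simp only [e]
  constructor
  · refine (Set.finite_singleton (κ s)).subset fun i hi => ?_
    by_contra hne
    exact hi (if_neg fun h => hne h.symm)
  · rw [finsum_eq_single _ (κ s) fun i hi => if_neg hi.symm, if_pos rfl]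

theorem rel_homogeneous (q : ℂ) (i : ℤ) : rel q i ∈ component (2 * i + 1) 2 :=
  fun s hs => bideg_of_relTerm q i s hs

theorem mon_mul_rel_mem (q : ℂ) (t : ℤ →₀ ℕ) (i : ℤ) :
    mon t * rel q i ∈ formalIdeal (rel q) := by
  classical
  refine Ideal.mul_mem_left _ _ ⟨fun j => if j = i then 1 else 0, fun s => ⟨?_, ?_⟩⟩
  · refine (Set.finite_singleton i).subset fun j hj => ?_
    by_contra hne
    rw [Set.mem_singleton_iff] at hne
    exact hj (by simp [hne, coeffA_zero])
  · rw [finsum_eq_single _ i]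
    · simp
    · intro j hj
      simp [hj, coeffA_zero]

/-- The coefficients of a series at the monomials of `window N n l`. -/
def restrict (N n : ℤ) (l : ℕ) : algA →ₗ[ℂ] (window N n l → ℂ) where
  toFun f s := coeffA s f
  map_add' f g := by ext s; exact coeffA_add s f g
  map_smul' c f := by ext s; exact coeffA_smul s c f

/-- The coefficients of a formal sum `∑ p_i y_i` in the window involve only finitely many
generators and finitely many coefficients of the `p_i`. -/
theorem restrict_mem_relSpace {N n : ℤ} {l : ℕ} {q : ℂ} {f : algA}
    (hf : f ∈ formalIdeal (rel q)) : restrict N n l f ∈ relSpace N n l q := by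
  classical
  obtain ⟨p, hp⟩ := hf
  have hT : (⋃ s ∈ window N n l, Set.Iic s).Finite :=
    (window_finite N n l).biUnion fun s _ => Set.finite_Iic s
  let T := hT.toFinset
  have hI : (⋃ u ∈ T, {i : ℤ | bideg u = (2 * i + 1, 2)}).Finite := by
    refine T.finite_toSet.biUnion fun u _ => Set.Subsingleton.finite ?_
    intro a ha b hb
    have := (Set.mem_ofPred_eq ▸ ha : bideg u = _).symm.trans hb
    simp only [Prod.mk.injEq] at this
    omega
  have h : restrict N n l f =
      ∑ i ∈ hI.toFinset, ∑ t ∈ T, coeffA t (p i) • row N n l q (t, i) := by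
    ext ⟨s, hs⟩
    have hmem : ∀ u, u ≤ s → u ∈ T := fun u hu =>
      hT.mem_toFinset.mpr (Set.mem_biUnion hs hu)
    simp only [Finset.sum_apply, Pi.smul_apply, smul_eq_mul]
    change coeffA s f = ∑ i ∈ hI.toFinset, ∑ t ∈ T, coeffA t (p i) * coeffA s (mon t * rel q i)
    have e : ∀ i, coeffA s (p i * rel q i) =
        ∑ t ∈ T, coeffA t (p i) * coeffA s (mon t * rel q i) := by
      intro i
      simp only [coeffA_mon_mul, mul_ite, mul_zero]
      rw [coeffA_mul, ← Finset.sum_filter]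
      refine Finset.sum_nbij' (fun v => v.1) (fun t => (t, s - t)) ?_ ?_ ?_ ?_ ?_
      · rintro ⟨t, u⟩ htu
        have htu : t + u = s := Finset.HasAntidiagonal.mem_antidiagonal.mp htu
        have hle : t ≤ s := htu ▸ le_self_add
        exact Finset.mem_filter.mpr ⟨hmem t hle, hle⟩
      · intro t ht
        exact Finset.HasAntidiagonal.mem_antidiagonal.mpr
          (add_tsub_cancel_of_le (Finset.mem_filter.mp ht).2)
      · rintro ⟨t, u⟩ htu
        have htu : t + u = s := Finset.HasAntidiagonal.mem_antidiagonal.mp htu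
        simp [← htu]
      · intro t _
        rfl
      · rintro ⟨t, u⟩ htu
        have htu : t + u = s := Finset.HasAntidiagonal.mem_antidiagonal.mp htu
        simp [← htu]
    rw [(hp s).2]
    simp only [e]
    refine finsum_eq_sum_of_support_subset _ fun i hi => ?_
    rw [Set.Finite.coe_toFinset]
    have hi : ∑ t ∈ T, coeffA t (p i) * coeffA s (mon t * rel q i) ≠ 0 := hi
    obtain ⟨t, ht, hne⟩ := Finset.exists_ne_zero_of_sum_ne_zero hi
    obtain ⟨α, hα⟩ := exists_of_coeffA_mon_mul_rel (right_ne_zero_of_mul hne)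
    refine Set.mem_biUnion (hmem (pair i α) ?_) (bideg_pair i α)
    rw [hα]
    exact le_add_self
  rw [h]
  exact Submodule.sum_mem _ fun i _ => Submodule.sum_mem _ fun t _ =>
    Submodule.smul_mem _ _ (Submodule.subset_span (Set.mem_range_self _))

theorem exists_restrict_eq {N n : ℤ} {l : ℕ} {q : ℂ} {w : window N n l → ℂ}
    (hw : w ∈ relSpace N n l q) :
    ∃ g ∈ component n l, g ∈ formalIdeal (rel q) ∧ restrict N n l g = w := by
  induction hw using Submodule.span_induction with
  | mem w hw =>
    obtain ⟨⟨t, i⟩, rfl⟩ := hw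
    by_cases h : lead (t, i) ∈ window N n l
    · refine ⟨mon t * rel q i, fun s hs => ?_, mon_mul_rel_mem q t i, rfl⟩
      obtain ⟨α, rfl⟩ := exists_of_coeffA_mon_mul_rel hs
      rw [← h.1, lead, bideg_add, bideg_add, bideg_pair, bideg_pair]
    · exact ⟨0, zero_mem _, zero_mem _, by rw [row_eq_zero h, map_zero]⟩
  | zero => exact ⟨0, zero_mem _, zero_mem _, map_zero _⟩
  | add v w _ _ hv hw =>
    obtain ⟨f, hf, hf', rfl⟩ := hv
    obtain ⟨g, hg, hg', rfl⟩ := hw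
    exact ⟨f + g, add_mem hf hg, add_mem hf' hg', map_add _ _ _⟩
  | smul c w _ hw =>
    obtain ⟨f, hf, hf', rfl⟩ := hw
    refine ⟨c • f, Submodule.smul_mem _ _ hf, ?_, map_smul _ _ _⟩
    rw [Algebra.smul_def]
    exact Ideal.mul_mem_left _ _ hf'

theorem restrict_surjective {N n : ℤ} {l : ℕ} (w : window N n l → ℂ) :
    ∃ f ∈ component n l, restrict N n l f = w := by
  classical
  let c : MvPowerSeries ℤ ℂ := fun s => if h : s ∈ window N n l then w ⟨s, h⟩ else 0
  have hc : ∀ s, MvPowerSeries.coeff s c ≠ 0 → bideg s = (n, l) := by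
    intro s hs
    by_contra hb
    exact hs (dif_neg fun h => hb h.1)
  refine ⟨⟨c, (Set.finite_singleton (n, l)).subset ?_⟩, hc, ?_⟩
  · rintro _ ⟨s, hs, rfl⟩
    exact hc s hs
  · ext s
    exact dif_pos s.2

/-- On a homogeneous component, membership in `I_q + C_N` is decided by the coefficients in the
window. -/
theorem mem_cutoff_sup_formalIdeal_iff {N n : ℤ} {l : ℕ} {q : ℂ} {f : algA}
    (hf : f ∈ component n l) :
    f ∈ cutoff N ⊔ formalIdeal (rel q) ↔ restrict N n l f ∈ relSpace N n l q := by
  constructor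
  · intro h
    obtain ⟨c, hc, g, hg, rfl⟩ := Submodule.mem_sup.mp h
    have : restrict N n l c = 0 := by
      ext s
      exact coeffA_eq_zero_of_mem_cutoff hc s.2.2
    rw [map_add, this, zero_add]
    exact restrict_mem_relSpace hg
  · intro h
    obtain ⟨g, hg, hg', hgf⟩ := exists_restrict_eq h
    have h0 : f - g ∈ cutoff N := by
      refine mem_cutoff_of_coeffA_eq_zero (sub_mem hf hg) fun s hs => ?_
      by_contra hne
      have hb := sub_mem hf hg s hne
      have := congrFun hgf ⟨s, hb, hs⟩
      rw [coeffA_sub] at hne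
      exact hne (sub_eq_zero.mpr this.symm)
    rw [← sub_add_cancel f g]
    exact Submodule.add_mem_sup h0 hg'

/-! ### The dimension of the cut-off components -/

theorem rank_range_eq_of_ker_eq {V W W' : Type} [AddCommGroup V] [Module ℂ V] [AddCommGroup W]
    [Module ℂ W] [AddCommGroup W'] [Module ℂ W'] (f : V →ₗ[ℂ] W) (g : V →ₗ[ℂ] W')
    (h : LinearMap.ker f = LinearMap.ker g) :
    Module.rank ℂ (LinearMap.range f) = Module.rank ℂ (LinearMap.range g) := by
  rw [← f.quotKerEquivRange.rank_eq, ← g.quotKerEquivRange.rank_eq, h]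

theorem dimCut_formalIdeal_rel (q : ℂ) (N n : ℤ) (l : ℕ) :
    dimCut (formalIdeal (rel q)) N n l =
      ((Nat.card (window N n l) - Nat.card (nonstandard N n l) : ℕ) : Cardinal) := by
  have := Fintype.ofFinite (window N n l)
  let φ := ((Ideal.Quotient.mkₐ ℂ ((cutoff N).map (Ideal.Quotient.mk (formalIdeal (rel q))))).comp
      (Ideal.Quotient.mkₐ ℂ (formalIdeal (rel q)))).toLinearMap
  let f := φ ∘ₗ (component n l).subtype
  let g : component n l →ₗ[ℂ] (window N n l → ℂ) ⧸ relSpace N n l q :=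
    (relSpace N n l q).mkQ ∘ₗ restrict N n l ∘ₗ (component n l).subtype
  have hker : LinearMap.ker f = LinearMap.ker g := by
    ext a
    have h1 : f a = 0 ↔ (a : algA) ∈ cutoff N ⊔ formalIdeal (rel q) := by
      rw [← Ideal.mem_quotient_iff_mem_sup]
      exact Ideal.Quotient.eq_zero_iff_mem
    have h2 : g a = 0 ↔ restrict N n l a ∈ relSpace N n l q :=
      Submodule.Quotient.mk_eq_zero _
    rw [LinearMap.mem_ker, LinearMap.mem_ker, h1, h2, mem_cutoff_sup_formalIdeal_iff a.2]
  have hg : LinearMap.range g = ⊤ := by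
    rw [LinearMap.range_eq_top]
    intro v
    obtain ⟨w, rfl⟩ := Submodule.mkQ_surjective _ v
    obtain ⟨a, ha, rfl⟩ := restrict_surjective w
    exact ⟨⟨a, ha⟩, rfl⟩
  have hf : (component n l).map φ = LinearMap.range f := by
    rw [LinearMap.range_comp, Submodule.range_subtype]
  change Module.rank ℂ ((component n l).map φ) = _
  rw [hf]
  refine (rank_range_eq_of_ker_eq (V := component n l)
    (W' := (window N n l → ℂ) ⧸ relSpace N n l q) f g hker).trans ?_
  rw [hg, rank_top, ← Module.finrank_eq_rank,
    Submodule.finrank_quotient, finrank_relSpace, Module.finrank_fintype_fun_eq_card,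
    ← Nat.card_eq_fintype_card]

theorem rel_zero (i : ℤ) : rel 0 i = x i * x (i + 1) := by
  classical
  have h : ∀ α : ℤ, α ≠ 0 → relCoeff 0 α = 0 := fun α hα => by
    have h1 := mul_three_mul_sub_one_pos hα
    have h2 : 2 ∣ α * (3 * α - 1) := by
      rcases Int.even_or_odd' α with ⟨k, rfl | rfl⟩
      · exact ⟨k * (3 * (2 * k) - 1), by ring⟩
      · exact ⟨(2 * k + 1) * (3 * k + 1), by ring⟩
    rw [relCoeff, zero_zpow _ (by omega), mul_zero]
  ext1
  ext s
  change coeffA s (rel 0 i) = coeffA s (x i * x (i + 1))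
  have h0 : relTerm 0 i 0 = x i * x (i + 1) := by simp [relTerm]
  rw [← h0, coeffA_relTerm_eq, coeffA_rel, finsum_eq_single _ 0]
  intro α hα
  rw [h α hα, ite_self]

end FlatDef

end

theorem theorem5p1 :
    FlatDef.IsDeformation FlatDef.rel (fun i : ℤ => FlatDef.x i * FlatDef.x (i + 1)) ∧
    ∀ q : ℂ, ‖q‖ < 1 →
      FlatDef.SameDims (FlatDef.formalIdeal (FlatDef.rel q))
        (FlatDef.formalIdeal fun i : ℤ => FlatDef.x i * FlatDef.x (i + 1)) := by
  constructor
  · refine ⟨fun i => ?_, fun i => ?_, FlatDef.rel_zero⟩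
    · refine ⟨Finsupp.single i 1 + Finsupp.single (i + 1) 1, ?_⟩
      rw [Finsupp.prod_add_index' (by simp) (by intros; rw [pow_add])]
      simp
    · exact ⟨2 * i + 1, 2, fun q => FlatDef.rel_homogeneous q i⟩
  · intro q _ N n l
    rw [← funext FlatDef.rel_zero]
    rw [FlatDef.dimCut_formalIdeal_rel, FlatDef.dimCut_formalIdeal_rel]
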